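/- Let $R=\bigoplus_{n\ge 0}R_n$ be a Noetherian commutative graded ring of Krull dimension $d$ such that $A=R_0$ is an Artinian local ring. Let $f_1,\dots,f_d$ be a homogeneous system of parameters for $R$, i.e. homogeneous elements, $d=\dim R$ in number, generating an ideal of height $d$, and let $J=(f_1,\dots,f_d)$. Let $$P(R,t)=\sum_{n\ge 0}\ell_A(R_n)\,t^n$$ be the Poincaré series of $R$, where $\ell_A$ denotes length over $A$, and let $$e(J)=\lim_{n\to\infty}\frac{d!\;\ell_R(R/J^n)}{n^d}$$ be the multiplicity of $J$. Then all the lengths $\ell_A(R_n)$ and $\ell_R(R/J^n)$ are finite, $P(R,t)$ converges for real $|t|<1$, the degrees $\deg f_i$ are positive, the limit defining $e(J)$ and the limit $\lim_{t\to1^-}(1-t)^dP(R,t)$ exist, and $$e(J)=\deg f_1\cdots\deg f_d\cdot\lim_{t\to 1^-}(1-t)^dP(R,t).$$ In particular the ratio $e(J)/\prod_{i=1}^d\deg f_i$ is the same for all ideals $J$ generated by a homogeneous system of parameters of $R$. -/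

import Mathlib

open Filter Topology

/-- The normalized Hilbert–Samuel function `n ↦ d! · ℓ_R(R / J ^ n) / n ^ d` of an ideal `J`,
with a given exponent `d`. -/
noncomputable def samuelQuotient {R : Type*} [CommRing R] (d : ℕ) (J : Ideal R) (n : ℕ) : ℝ :=
  (Nat.factorial d : ℝ) * ((Module.length R (R ⧸ J ^ n)).toNat : ℝ) / (n : ℝ) ^ d

/-- The (Hilbert–Samuel) multiplicity `e(J) = lim_n d! · ℓ_R(R / J ^ n) / n ^ d`, where `d` is the
Krull dimension of `R`. It is meant for rings of finite dimension and ideals `J` such that all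
the lengths `ℓ_R(R / J ^ n)` are finite and the limit exists. -/
noncomputable def samuelMultiplicity {R : Type*} [CommRing R] (J : Ideal R) : ℝ :=
  limUnder atTop (samuelQuotient ((ringKrullDim R).unbotD 0).toNat J)

/-- The homogeneous component `Rₙ` of a graded ring `R = ⨁ₙ Rₙ`, as a module over `R₀`. -/
def gradedPiece {R σ : Type*} [CommRing R] [SetLike σ R] [AddSubgroupClass σ R]
    (𝒜 : ℕ → σ) [GradedRing 𝒜] (n : ℕ) : Submodule (𝒜 0) R where
  carrier := {x | x ∈ 𝒜 n}
  add_mem' := fun hx hy => add_mem hx hy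
  zero_mem' := zero_mem (𝒜 n)
  smul_mem' := fun a x hx => by
    have h : (a : R) * x ∈ 𝒜 (0 + n) := SetLike.GradedMul.mul_mem a.2 hx
    rw [zero_add] at h
    exact h

/-- The value at `t` of the Poincaré series `P(R, t) = ∑ₙ ℓ_A(Rₙ) tⁿ` of a graded ring
`R = ⨁ₙ Rₙ`, where `A = R₀`. -/
noncomputable def poincareSeries {R σ : Type*} [CommRing R] [SetLike σ R] [AddSubgroupClass σ R]
    (𝒜 : ℕ → σ) [GradedRing 𝒜] (t : ℝ) : ℝ :=
  ∑' n : ℕ, ((Module.length (𝒜 0) (gradedPiece 𝒜 n)).toNat : ℝ) * t ^ n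

/-- `f₁, …, f_d` is a (full) homogeneous system of parameters of the graded ring `R`, with `fᵢ`
homogeneous of degree `bᵢ`: the number `d` of elements is the dimension of `R`, and
the ideal `(f₁, …, f_d)` has height `d`. (In Mathlib the unit ideal has height `⊤`, so this ideal
is automatically proper.) -/
structure IsHomogeneousSOP {R σ : Type*} [CommRing R] [SetLike σ R] [AddSubgroupClass σ R]
    (𝒜 : ℕ → σ) [GradedRing 𝒜] {d : ℕ} (f : Fin d → R) (b : Fin d → ℕ) : Prop where
  dim_eq : ringKrullDim R = d
  mem_deg : ∀ i, f i ∈ 𝒜 (b i)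
  height_eq : (Ideal.span (Set.range f)).height = d

open DirectSum
open scoped Polynomial

/-! Both limits are read off one two-variable series. The associated graded ring `⨁ J^n / J^(n+1)`
is bigraded by filtration degree (variable `s`) and internal degree (variable `t`), and
multiplication by `fᵢ` has bidegree `(1, bᵢ)`. A Hilbert–Serre induction
(`exists_bigradedHilbert_mul_prod_eq`) shows that its Hilbert series is `Q(s,t) / ∏ (1 - t^bᵢ s)`
with `Q` a polynomial. At `t = 1` this is `∑ ℓ(J^n/J^(n+1)) s^n = Q(s,1)/(1-s)^d`, so `e(J) =
Q(1,1)` (`tendsto_samuelQuotient`). At `s = 1` and `0 ≤ t < 1` the sum over `n` telescopes to the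
Poincaré series, because `J^n` lives in degrees at least `n`; hence `P(R,t) = Q(1,t)/∏ (1 - t^bᵢ)`
(`hasSum_hilbertFun_top`). Multiplying by `(1-t)^d` and letting `t → 1` gives `Q(1,1)/∏ bᵢ`. The
induction works with pairs of filtrations `G ≤ F` by ideals of `R`, the pair standing for the module
`⨁ F n / G n`. Kernel and cokernel of multiplication by `fᵢ` are again such pairs, so the associated
graded ring itself is never built. -/

/-! ### Additivity and change of rings for length. -/

/-- Additivity along `0 → P ⊓ μ⁻¹Q → Q × P → Q + μP → 0`, where the first map is `x ↦ (-μ x, x)`. -/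
lemma Module.length_sup_map_add_length_inf_comap {A M M' : Type*} [CommRing A] [AddCommGroup M]
    [Module A M] [AddCommGroup M'] [Module A M'] (μ : M →ₗ[A] M') (P : Submodule A M)
    (Q : Submodule A M') :
    Module.length A ↥(Q ⊔ P.map μ) + Module.length A ↥(P ⊓ Q.comap μ) =
      Module.length A Q + Module.length A P := by
  let g : (Q × P) →ₗ[A] ↥(Q ⊔ P.map μ) :=
    LinearMap.coprod (Submodule.inclusion le_sup_left)
      ((μ.restrict (p := P) (q := Q ⊔ P.map μ)
        fun x hx => Submodule.mem_sup_right (Submodule.mem_map_of_mem hx)))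
  let f : ↥(P ⊓ Q.comap μ) →ₗ[A] (Q × P) :=
    LinearMap.prod (-(μ.restrict (p := P ⊓ Q.comap μ) (q := Q) fun x hx => hx.2))
      (Submodule.inclusion inf_le_left)
  have hf : Function.Injective f := fun x y h => by
    have := congrArg (fun z => (z.2 : M)) h
    exact Subtype.ext this
  have hg : Function.Surjective g := by
    rintro ⟨z, hz⟩
    obtain ⟨q, hq, _, ⟨p, hp, rfl⟩, rfl⟩ := Submodule.mem_sup.1 hz
    exact ⟨(⟨q, hq⟩, ⟨p, hp⟩), Subtype.ext rfl⟩
  have hfg : Function.Exact f g := by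
    rintro ⟨⟨q, hq⟩, ⟨p, hp⟩⟩
    constructor
    · intro h
      have h' : q + μ p = 0 := congrArg Subtype.val h
      have h2 : μ p = -q := by rw [eq_neg_iff_add_eq_zero, add_comm]; exact h'
      refine ⟨⟨p, hp, ?_⟩, ?_⟩
      · change μ p ∈ Q
        rw [h2]; exact neg_mem hq
      · refine Prod.ext (Subtype.ext ?_) (Subtype.ext rfl)
        change -μ p = q
        rw [h2, neg_neg]
    · rintro ⟨⟨x, hx⟩, h⟩
      rw [← h]
      refine Subtype.ext ?_
      change -μ x + μ x = 0
      simp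
  rw [← Module.length_prod (R := A) (M := Q) (N := P), Module.length_eq_add_of_exact f g hf hg hfg, add_comm]

/-- The `A`-submodules and the `R`-submodules are the same sets, and length is the height of the top
element of this lattice. -/
lemma Module.length_eq_length_of_forall_exists_smul_eq {A R N : Type*} [CommRing A] [CommRing R]
    [Algebra A R] [AddCommGroup N] [Module R N] [Module A N] [IsScalarTower A R N]
    (h : ∀ (r : R) (x : N), ∃ a : A, r • x = a • x) : Module.length A N = Module.length R N := by
  let e : Submodule R N ≃o Submodule A N :=
    { toFun := fun p => p.restrictScalars A
      invFun := fun p =>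
        { p with
          smul_mem' := fun r x hx => by
            obtain ⟨a, ha⟩ := h r x
            rw [ha]
            exact p.smul_mem a hx }
      left_inv := fun p => rfl
      right_inv := fun p => rfl
      map_rel_iff' := Iff.rfl }
  rw [Module.length_eq_height, Module.length_eq_height, ← Order.height_orderIso e]
  rfl

/-! ### Graded pieces of ideals and lengths of graded quotients. -/

section Graded

variable {R σ : Type*} [CommRing R] [SetLike σ R] [AddSubgroupClass σ R]
  (𝒜 : ℕ → σ) [GradedRing 𝒜]

lemma mem_gradedPiece {n : ℕ} {x : R} : x ∈ gradedPiece 𝒜 n ↔ x ∈ 𝒜 n := Iff.rfl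

/-- The degree `n` part of the ideal generated by `N ⊆ Rₙ` is `N` itself, so `N ↦ NR` embeds the
submodules of `Rₙ` into the ideals of `R`. -/
instance isNoetherian_gradedPiece [IsNoetherianRing R] (n : ℕ) :
    IsNoetherian (𝒜 0) (gradedPiece 𝒜 n) := by
  let Φ : Submodule (𝒜 0) (gradedPiece 𝒜 n) → Ideal R := fun N =>
    Ideal.span (Subtype.val '' (N : Set (gradedPiece 𝒜 n)))
  have hmono : Monotone Φ := fun N N' h => Ideal.span_mono (Set.image_mono h)
  have key : ∀ (N : Submodule (𝒜 0) (gradedPiece 𝒜 n)) (y : R), y ∈ Φ N →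
      (decompose 𝒜 y n : R) ∈ N.map (gradedPiece 𝒜 n).subtype := by
    intro N y hy
    suffices ∀ r : R, (decompose 𝒜 (r * y) n : R) ∈ N.map (gradedPiece 𝒜 n).subtype by
      simpa only [one_mul] using this 1
    induction hy using Submodule.span_induction with
    | mem x hx =>
      obtain ⟨x, hx, rfl⟩ := hx
      intro r
      rw [coe_decompose_mul_of_right_mem_of_le 𝒜 x.2 le_rfl, Nat.sub_self]
      exact ⟨(decompose 𝒜 r 0) • x, N.smul_mem _ hx, rfl⟩
    | zero => simp
    | add x y _ _ hx hy =>
      intro r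
      rw [mul_add, decompose_add]
      exact add_mem (hx r) (hy r)
    | smul s x hx h =>
      intro r
      rw [smul_eq_mul, ← mul_assoc]
      exact h _
  have hinj : Function.Injective Φ := by
    have hle : ∀ N N' : Submodule (𝒜 0) (gradedPiece 𝒜 n), Φ N = Φ N' → N ≤ N' := by
      intro N N' h x hx
      have h1 : (x : R) ∈ Φ N' := h ▸ Ideal.subset_span ⟨x, hx, rfl⟩
      obtain ⟨z, hz, hzx⟩ := key N' _ h1
      rw [decompose_of_mem_same 𝒜 x.2] at hzx
      rwa [← Subtype.ext hzx]
    exact fun N N' h => le_antisymm (hle _ _ h) (hle _ _ h.symm)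
  rw [isNoetherian_iff']
  exact (hmono.strictMono_of_injective hinj).wellFoundedGT

/-- The degree `n` part of an ideal of a graded ring, as a module over the degree zero part. -/
def idealPiece (I : Ideal R) (n : ℕ) : Submodule (𝒜 0) R :=
  gradedPiece 𝒜 n ⊓ I.restrictScalars (𝒜 0)

variable {𝒜}

lemma mem_idealPiece {I : Ideal R} {n : ℕ} {x : R} : x ∈ idealPiece 𝒜 I n ↔ x ∈ 𝒜 n ∧ x ∈ I :=
  Iff.rfl

lemma idealPiece_mono {I I' : Ideal R} (h : I ≤ I') (n : ℕ) :
    idealPiece 𝒜 I n ≤ idealPiece 𝒜 I' n := fun _ hx => ⟨hx.1, h hx.2⟩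

lemma idealPiece_top (n : ℕ) : idealPiece 𝒜 ⊤ n = gradedPiece 𝒜 n := by
  ext x; simp [mem_idealPiece, mem_gradedPiece]

open Pointwise in
lemma idealPiece_sup_smul {N I : Ideal R} (hN : N.IsHomogeneous 𝒜) (hI : I.IsHomogeneous 𝒜)
    {f : R} {b : ℕ} (hf : f ∈ 𝒜 b) (m : ℕ) :
    idealPiece 𝒜 (N ⊔ f • I) (m + b) =
      idealPiece 𝒜 N (m + b) ⊔ (idealPiece 𝒜 I m).map (LinearMap.mulLeft (𝒜 0) f) := by
  apply le_antisymm
  · rintro x ⟨hx, hx'⟩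
    obtain ⟨n, hn, _, ⟨y, hy, rfl⟩, rfl⟩ := Submodule.mem_sup.1 hx'
    rw [← decompose_of_mem_same 𝒜 hx]
    simp only [decompose_add, DirectSum.add_apply, AddMemClass.coe_add]
    refine Submodule.add_mem_sup ⟨SetLike.coe_mem _, hN _ hn⟩
      ⟨decompose 𝒜 y m, ⟨SetLike.coe_mem _, hI _ hy⟩, ?_⟩
    rw [add_comm m b]
    exact (coe_decompose_mul_add_of_left_mem 𝒜 hf).symm
  · refine sup_le (idealPiece_mono le_sup_left _) ?_
    rintro _ ⟨y, ⟨hy, hy'⟩, rfl⟩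
    refine ⟨?_, Submodule.mem_sup_right (Submodule.smul_mem_pointwise_smul _ _ _ hy')⟩
    rw [add_comm]
    exact SetLike.mul_mem_graded (A := 𝒜) hf hy

open Pointwise in
lemma idealPiece_sup_smul_of_lt {N I : Ideal R} (hN : N.IsHomogeneous 𝒜)
    {f : R} {b : ℕ} (hf : f ∈ 𝒜 b) {m : ℕ} (hm : m < b) :
    idealPiece 𝒜 (N ⊔ f • I) m = idealPiece 𝒜 N m := by
  apply le_antisymm
  · rintro x ⟨hx, hx'⟩
    obtain ⟨n, hn, _, ⟨y, hy, rfl⟩, rfl⟩ := Submodule.mem_sup.1 hx'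
    rw [← decompose_of_mem_same 𝒜 hx]
    simp only [decompose_add, DirectSum.add_apply, AddMemClass.coe_add]
    have : (decompose 𝒜 (f * y) m : R) = 0 :=
      coe_decompose_mul_of_left_mem_of_not_le 𝒜 hf (not_le.2 hm)
    refine add_mem ⟨SetLike.coe_mem _, hN _ hn⟩ ?_
    change (decompose 𝒜 (f * y) m : R) ∈ _
    rw [this]
    exact zero_mem _
  · exact idealPiece_mono le_sup_left _

open Pointwise in
-- Additivity for multiplication by `f` from degree `m` of `I` to degree `m + b` modulo `N`. Lengths
-- lie in `ℕ∞`, hence the form without subtraction.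
lemma length_idealPiece_sup_smul {N I : Ideal R} (hN : N.IsHomogeneous 𝒜)
    (hI : I.IsHomogeneous 𝒜) {f : R} {b : ℕ} (hf : f ∈ 𝒜 b) (m : ℕ) :
    Module.length (𝒜 0) (idealPiece 𝒜 (N ⊔ f • I) (m + b)) +
      Module.length (𝒜 0) (idealPiece 𝒜 (I ⊓ Submodule.comap (LinearMap.mulLeft R f) N) m) =
    Module.length (𝒜 0) (idealPiece 𝒜 N (m + b)) + Module.length (𝒜 0) (idealPiece 𝒜 I m) := by
  rw [← Module.length_sup_map_add_length_inf_comap (LinearMap.mulLeft (𝒜 0) f)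
    (idealPiece 𝒜 I m) (idealPiece 𝒜 N (m + b)),
    idealPiece_sup_smul hN hI hf]
  have : idealPiece 𝒜 (I ⊓ Submodule.comap (LinearMap.mulLeft R f) N) m =
      idealPiece 𝒜 I m ⊓ (idealPiece 𝒜 N (m + b)).comap (LinearMap.mulLeft (𝒜 0) f) := by
    ext x
    simp only [mem_idealPiece, Submodule.mem_inf, Submodule.mem_comap, LinearMap.mulLeft_apply]
    refine ⟨fun h => ⟨⟨h.1, h.2.1⟩, ?_, h.2.2⟩, fun h => ⟨h.1.1, h.1.2, h.2.2⟩⟩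
    rw [add_comm]
    exact SetLike.mul_mem_graded (A := 𝒜) hf h.1
  rw [this]

lemma decompose_mem_of_mem_sup_span {I : Ideal R} (hI : I.IsHomogeneous 𝒜) {m M : ℕ} (hm : m < M)
    {x : R} (hx : x ∈ I ⊔ Ideal.span (𝒜 M : Set R)) : (decompose 𝒜 x m : R) ∈ I := by
  obtain ⟨n, hn, y, hy, rfl⟩ := Submodule.mem_sup.1 hx
  rw [decompose_add, DirectSum.add_apply, AddMemClass.coe_add]
  refine add_mem (hI _ hn) ?_
  suffices ∀ r : R, (decompose 𝒜 (r * y) m : R) = 0 by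
    have h := this 1
    rw [one_mul] at h
    rw [h]
    exact zero_mem _
  clear hx
  induction hy using Submodule.span_induction with
  | mem x hx => exact fun r => coe_decompose_mul_of_right_mem_of_not_le 𝒜 hx (not_le.2 hm)
  | zero => simp
  | add x y _ _ hx hy =>
    intro r
    rw [mul_add, decompose_add, DirectSum.add_apply, AddMemClass.coe_add, hx, hy, add_zero]
  | smul s x hx h =>
    intro r
    rw [smul_eq_mul, ← mul_assoc]
    exact h _

lemma isHomogeneous_sup_span {I : Ideal R} (hI : I.IsHomogeneous 𝒜) (M : ℕ) :
    (I ⊔ Ideal.span (𝒜 M : Set R)).IsHomogeneous 𝒜 :=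
  hI.sup (Ideal.homogeneous_span 𝒜 _ fun _ hx => ⟨M, hx⟩)

lemma mem_of_forall_decompose_mem {I : Ideal R} (hI : I.IsHomogeneous 𝒜) {M : ℕ}
    (hM : ∀ m, M < m → (𝒜 m : Set R) ⊆ I) {x : R}
    (hx : ∀ m ≤ M, (decompose 𝒜 x m : R) ∈ I) : x ∈ I := by
  rw [hI.mem_iff]
  intro m
  rcases le_or_gt m M with h | h
  · exact hx m h
  · exact hM m h (SetLike.coe_mem _)

/-- Peels off the top degree `M` of `R / I`. Elements of positive degree kill that part, so `R` acts
on it through `R₀` and its lengths over the two rings agree. -/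
lemma length_quotient_eq_add {I : Ideal R} (hI : I.IsHomogeneous 𝒜) {M : ℕ}
    (hM : ∀ m, M < m → (𝒜 m : Set R) ⊆ I) :
    Module.length R (R ⧸ I) + Module.length (𝒜 0) (idealPiece 𝒜 I M) =
      Module.length R (R ⧸ (I ⊔ Ideal.span (𝒜 M : Set R))) +
        Module.length (𝒜 0) (gradedPiece 𝒜 M) := by
  set I' := I ⊔ Ideal.span (𝒜 M : Set R)
  let N : Submodule R (R ⧸ I) := Submodule.map I.mkQ I'
  -- Components of `x ∈ I'` in degrees below `M` already lie in `I`, and those above `M` do by `hM`;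
  -- only degree `M` survives.
  have hrep : ∀ z ∈ N, ∃ x ∈ 𝒜 M, I.mkQ x = z := by
    rintro _ ⟨x, hx, rfl⟩
    refine ⟨decompose 𝒜 x M, SetLike.coe_mem _, ?_⟩
    rw [← sub_eq_zero, ← map_sub, Submodule.mkQ_apply, Submodule.Quotient.mk_eq_zero]
    refine mem_of_forall_decompose_mem hI hM fun m hm => ?_
    rw [decompose_sub, DirectSum.sub_apply, AddSubgroupClass.coe_sub]
    rcases hm.lt_or_eq with h | rfl
    · rw [decompose_of_mem_ne 𝒜 (SetLike.coe_mem _) h.ne', zero_sub]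
      exact neg_mem (decompose_mem_of_mem_sup_span hI h hx)
    · rw [decompose_of_mem_same 𝒜 (SetLike.coe_mem _), sub_self]
      exact zero_mem _
  have hN : Module.length (𝒜 0) N = Module.length R N := by
    apply Module.length_eq_length_of_forall_exists_smul_eq
    rintro r ⟨z, hz⟩
    obtain ⟨x, hx, rfl⟩ := hrep z hz
    refine ⟨decompose 𝒜 r 0, Subtype.ext ?_⟩
    change r • I.mkQ x = I.mkQ ((decompose 𝒜 r 0 : R) * x)
    rw [← map_smul, ← sub_eq_zero, ← map_sub, Submodule.mkQ_apply,
      Submodule.Quotient.mk_eq_zero]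
    refine mem_of_forall_decompose_mem hI hM fun m hm => ?_
    rw [decompose_sub, DirectSum.sub_apply, AddSubgroupClass.coe_sub, smul_eq_mul,
      coe_decompose_mul_of_left_mem_zero 𝒜 (SetLike.coe_mem _)]
    rcases hm.lt_or_eq with h | rfl
    · rw [coe_decompose_mul_of_right_mem_of_not_le 𝒜 hx (not_le.2 h),
        decompose_of_mem_ne 𝒜 hx h.ne']
      simp
    · rw [coe_decompose_mul_of_right_mem_of_le 𝒜 hx le_rfl, Nat.sub_self,
        decompose_of_mem_same 𝒜 hx, sub_self]
      exact zero_mem _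
  have h1 : Module.length R (R ⧸ I) = Module.length R N + Module.length R (R ⧸ I') := by
    refine Module.length_eq_add_of_exact N.subtype (Submodule.factor (le_sup_left : I ≤ I'))
      N.subtype_injective (Submodule.factor_surjective _) ?_
    rw [LinearMap.exact_iff, Submodule.range_subtype]
    ext z
    obtain ⟨x, rfl⟩ := I.mkQ_surjective z
    constructor
    · intro h
      have : x ∈ I' := by
        exact (Submodule.Quotient.mk_eq_zero I').1 h
      exact ⟨x, this, rfl⟩
    · rintro ⟨y, hy, hyx⟩
      rw [← hyx]
      exact (Submodule.Quotient.mk_eq_zero I').2 hy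
  have h2 : Module.length (𝒜 0) (gradedPiece 𝒜 M) =
      Module.length (𝒜 0) (idealPiece 𝒜 I M) + Module.length (𝒜 0) N := by
    let g : gradedPiece 𝒜 M →ₗ[𝒜 0] N :=
      LinearMap.codRestrict (N.restrictScalars (𝒜 0))
        ((I.mkQ.restrictScalars (𝒜 0)).comp (gradedPiece 𝒜 M).subtype)
        fun x => ⟨x, Submodule.mem_sup_right (Ideal.subset_span x.2), rfl⟩
    refine Module.length_eq_add_of_exact (Submodule.inclusion inf_le_left) g
      (Submodule.inclusion_injective _) ?_ ?_
    · rintro ⟨z, hz⟩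
      obtain ⟨x, hx, rfl⟩ := hrep z hz
      exact ⟨⟨x, hx⟩, rfl⟩
    · intro x
      have : g x = 0 ↔ (x : R) ∈ I := by
        rw [← Submodule.Quotient.mk_eq_zero]
        exact Subtype.ext_iff
      rw [this]
      exact ⟨fun h => ⟨⟨x, x.2, h⟩, rfl⟩, fun ⟨y, hy⟩ => hy ▸ y.2.2⟩
  rw [h1, h2, ← hN]
  ring

/-- The length of a graded quotient is the sum of the lengths of its graded pieces. -/
lemma length_quotient_add_sum (M : ℕ) : ∀ {I : Ideal R} (_ : I.IsHomogeneous 𝒜)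
    (_ : ∀ m, M ≤ m → (𝒜 m : Set R) ⊆ I),
    Module.length R (R ⧸ I) + ∑ m ∈ Finset.range M, Module.length (𝒜 0) (idealPiece 𝒜 I m) =
      ∑ m ∈ Finset.range M, Module.length (𝒜 0) (gradedPiece 𝒜 m) := by
  induction M with
  | zero =>
    intro I _ h
    have : I = ⊤ := (Ideal.eq_top_iff_one _).2 (h 0 le_rfl SetLike.GradedOne.one_mem)
    subst this
    simp only [Finset.range_zero, Finset.sum_empty, add_zero]
    exact Module.length_eq_zero
  | succ M ih =>
    intro I hI h
    rw [Finset.sum_range_succ, Finset.sum_range_succ, add_comm (∑ _ ∈ _, _), ← add_assoc,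
      length_quotient_eq_add hI fun m hm => h m hm,
      ← ih (isHomogeneous_sup_span hI M) fun m hm => ?_]
    · have : ∀ m ∈ Finset.range M, Module.length (𝒜 0) (idealPiece 𝒜 I m) =
          Module.length (𝒜 0) (idealPiece 𝒜 (I ⊔ Ideal.span (𝒜 M : Set R)) m) := by
        intro m hm
        have : idealPiece 𝒜 I m = idealPiece 𝒜 (I ⊔ Ideal.span (𝒜 M : Set R)) m := by
          refine le_antisymm (idealPiece_mono le_sup_left m) fun x hx => ⟨hx.1, ?_⟩
          rw [← decompose_of_mem_same 𝒜 hx.1]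
          exact decompose_mem_of_mem_sup_span hI (Finset.mem_range.1 hm) hx.2
        rw [this]
      rw [Finset.sum_congr rfl this]
      ring
    · rcases hm.lt_or_eq with h' | rfl
      · exact (h m h').trans (SetLike.coe_subset_coe.2 le_sup_left)
      · exact Ideal.subset_span.trans (SetLike.coe_subset_coe.2 le_sup_right)

end Graded

/-- The ideal contains all homogeneous elements of large degree. -/
def ContainsTail {R σ : Type*} [CommRing R] [SetLike σ R] (𝒜 : ℕ → σ) (I : Ideal R) : Prop :=
  ∃ M, ∀ m, M ≤ m → (𝒜 m : Set R) ⊆ I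

lemma ContainsTail.mono {R σ : Type*} [CommRing R] [SetLike σ R] {𝒜 : ℕ → σ} {I I' : Ideal R} (h : ContainsTail 𝒜 I) (hle : I ≤ I') :
    ContainsTail 𝒜 I' :=
  let ⟨M, hM⟩ := h
  ⟨M, fun m hm => (hM m hm).trans hle⟩

/-! ### Homogeneous parameter ideals: finite colength and positive degrees. -/

section Graded

variable {R σ : Type*} [CommRing R] [SetLike σ R] [AddSubgroupClass σ R]
  {𝒜 : ℕ → σ} [GradedRing 𝒜]

lemma Ideal.IsHomogeneous.pow {I : Ideal R} (hI : I.IsHomogeneous 𝒜) (n : ℕ) :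
    (I ^ n).IsHomogeneous 𝒜 := by
  induction n with
  | zero => rw [pow_zero, Ideal.one_eq_top]; exact Ideal.IsHomogeneous.top 𝒜
  | succ n ih => rw [pow_succ]; exact ih.mul hI

lemma decompose_eq_zero_of_mem_span {k m : ℕ} (hm : m < k) {y : R}
    (hy : y ∈ Ideal.span (⋃ i ≥ k, (𝒜 i : Set R))) : (decompose 𝒜 y m : R) = 0 := by
  suffices ∀ r : R, (decompose 𝒜 (r * y) m : R) = 0 by simpa only [one_mul] using this 1
  induction hy using Submodule.span_induction with
  | mem x hx =>
    obtain ⟨i, hi, hx⟩ := Set.mem_iUnion₂.1 hx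
    exact fun r => coe_decompose_mul_of_right_mem_of_not_le 𝒜 hx (not_le.2 (hm.trans_le hi))
  | zero => simp
  | add x y _ _ hx hy =>
    intro r
    rw [mul_add, decompose_add, DirectSum.add_apply, AddMemClass.coe_add, hx, hy, add_zero]
  | smul s x hx h =>
    intro r
    rw [smul_eq_mul, ← mul_assoc]
    exact h _

/-- The images of the ideals `T k` generated in degrees at least `k` stabilize in `R / I`. From then
on, an `x` of degree `m` is congruent modulo `I` to an element of `T (m + 1)`, and the degree `m`
component of this congruence says `x ∈ I`. -/
lemma containsTail_of_isArtinian {I : Ideal R} (hI : I.IsHomogeneous 𝒜) [IsArtinian R (R ⧸ I)] :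
    ContainsTail 𝒜 I := by
  let T : ℕ → Ideal R := fun k => Ideal.span (⋃ i ≥ k, (𝒜 i : Set R))
  let F : ℕ →o (Submodule R (R ⧸ I))ᵒᵈ :=
    { toFun := fun k => OrderDual.toDual (Submodule.map I.mkQ (T k))
      monotone' := fun j k hjk => Submodule.map_mono (Ideal.span_mono
        (Set.iUnion₂_subset fun i hi => Set.subset_iUnion₂_of_subset i (hjk.trans hi) le_rfl)) }
  obtain ⟨n, hn⟩ := IsArtinian.monotone_stabilizes F
  refine ⟨n, fun m hm x hx => ?_⟩
  have h1 : I.mkQ x ∈ Submodule.map I.mkQ (T m) :=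
    ⟨x, Ideal.subset_span (Set.mem_iUnion₂.2 ⟨m, le_rfl, hx⟩), rfl⟩
  have h2 : Submodule.map I.mkQ (T m) = Submodule.map I.mkQ (T (m + 1)) :=
    congrArg OrderDual.ofDual ((hn m hm).symm.trans (hn (m + 1) (by omega)))
  rw [h2] at h1
  obtain ⟨y, hy, hyx⟩ := h1
  rw [← sub_eq_zero, ← map_sub, Submodule.mkQ_apply, Submodule.Quotient.mk_eq_zero] at hyx
  have h3 := hI m hyx
  rw [decompose_sub, DirectSum.sub_apply, AddSubgroupClass.coe_sub, decompose_of_mem_same 𝒜 hx,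
    decompose_eq_zero_of_mem_span (Nat.lt_succ_self m) hy, zero_sub] at h3
  exact neg_mem_iff.1 h3

namespace IsHomogeneousSOP

variable {d : ℕ} {f : Fin d → R} {b : Fin d → ℕ}

lemma isHomogeneous_span (hf : IsHomogeneousSOP 𝒜 f b) :
    (Ideal.span (Set.range f)).IsHomogeneous 𝒜 :=
  Ideal.homogeneous_span 𝒜 _ (by rintro _ ⟨i, rfl⟩; exact ⟨b i, hf.mem_deg i⟩)

/-- Such a prime has height at least `d = dim R`. -/
lemma isMaximal_of_le (hf : IsHomogeneousSOP 𝒜 f b) {P : Ideal R} [P.IsPrime]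
    (hP : Ideal.span (Set.range f) ≤ P) : P.IsMaximal := by
  have : FiniteRingKrullDim R := by
    rw [finiteRingKrullDim_iff_ne_bot_and_top, hf.dim_eq]
    exact ⟨WithBot.coe_ne_bot, fun h => ENat.natCast_ne_top d (WithBot.coe_injective h)⟩
  apply Ideal.isMaximal_of_height_eq_ringKrullDim
  refine le_antisymm Ideal.height_le_ringKrullDim_of_isPrime ?_
  rw [hf.dim_eq]
  have := Ideal.height_mono hP
  rw [hf.height_eq] at this
  exact_mod_cast this

lemma span_ne_top (hf : IsHomogeneousSOP 𝒜 f b) : Ideal.span (Set.range f) ≠ ⊤ := by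
  intro h
  have := hf.height_eq
  rw [h, Ideal.height_top] at this
  exact ENat.natCast_ne_top d this.symm

lemma isArtinian_quotient_pow [IsNoetherianRing R] (hf : IsHomogeneousSOP 𝒜 f b) (n : ℕ) :
    IsArtinian R (R ⧸ Ideal.span (Set.range f) ^ n) := by
  set J := Ideal.span (Set.range f)
  have : IsArtinianRing (R ⧸ J ^ n) := by
    rw [isArtinianRing_iff_isNoetherianRing_krullDimLE_zero]
    refine ⟨inferInstance,
      Ideal.krullDimLE_zero_quotient_iff_forall_minimalPrimes_isMaximal.2 fun P hP => ?_⟩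
    have := hP.1.1
    exact hf.isMaximal_of_le (Ideal.IsPrime.le_of_pow_le hP.1.2)
  exact isArtinian_of_surjective_algebraMap (Ideal.Quotient.mk_surjective (I := J ^ n))

lemma containsTail_pow [IsNoetherianRing R] (hf : IsHomogeneousSOP 𝒜 f b) (n : ℕ) :
    ContainsTail 𝒜 (Ideal.span (Set.range f) ^ n) :=
  have := hf.isArtinian_quotient_pow n
  containsTail_of_isArtinian (hf.isHomogeneous_span.pow n)

/-- A parameter of degree zero is a nonunit of the Artinian local ring `R₀`, hence nilpotent. Then a
prime minimal over the other `d - 1` parameters contains all of `J`, and Krull's height theorem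
bounds its height by `d - 1`, a contradiction. -/
lemma deg_pos [IsNoetherianRing R] [IsArtinianRing (𝒜 0)] [IsLocalRing (𝒜 0)]
    (hf : IsHomogeneousSOP 𝒜 f b) (i : Fin d) : 0 < b i := by
  by_contra hi
  have hi0 : f i ∈ 𝒜 0 := by
    have := hf.mem_deg i
    rwa [Nat.eq_zero_of_not_pos hi] at this
  have hu : ¬ IsUnit (⟨f i, hi0⟩ : 𝒜 0) := fun h =>
    hf.span_ne_top (Ideal.eq_top_of_isUnit_mem _ (Ideal.subset_span ⟨i, rfl⟩)
      (h.map (algebraMap (𝒜 0) R)))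
  have hnil : IsNilpotent (f i) := by
    have : IsNilpotent (⟨f i, hi0⟩ : 𝒜 0) := by
      have hK := (isArtinianRing_iff_isNoetherianRing_krullDimLE_zero (R := 𝒜 0)).1 ‹_›
      have := hK.2
      exact Ring.KrullDimLE.isNilpotent_iff_mem_nonunits.2 hu
    exact this.map (algebraMap (𝒜 0) R)
  classical
  let s : Finset R := (Finset.univ.erase i).image f
  have hs : Ideal.span (s : Set R) ≤ Ideal.span (Set.range f) := by
    refine Ideal.span_mono ?_
    simp only [s, Finset.coe_image]
    exact Set.image_subset_range _ _
  obtain ⟨P, hP⟩ := Ideal.nonempty_minimalPrimes (ne_top_of_le_ne_top hf.span_ne_top hs)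
  have := hP.1.1
  have hJP : Ideal.span (Set.range f) ≤ P := by
    rw [Ideal.span_le]
    rintro _ ⟨j, rfl⟩
    by_cases hj : j = i
    · subst hj
      obtain ⟨n, hn⟩ := hnil
      exact Ideal.IsPrime.mem_of_pow_mem ‹_› n (hn ▸ zero_mem _)
    · exact hP.1.2 (Ideal.subset_span (Finset.mem_coe.2
        (Finset.mem_image_of_mem f (Finset.mem_erase.2 ⟨hj, Finset.mem_univ j⟩))))
  have h1 := Ideal.height_mono hJP
  have h2 := Ideal.height_le_card_of_mem_minimalPrimes_span_finset hP
  rw [hf.height_eq] at h1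
  have h3 : s.card ≤ d - 1 := Finset.card_image_le.trans (by simp)
  have h4 : d ≤ s.card := by exact_mod_cast h1.trans h2
  have := i.pos
  omega

end IsHomogeneousSOP

/-! ### Hilbert series of graded quotients of finite length. -/

section Hilbert

lemma length_idealPiece_ne_top [IsNoetherianRing R] [IsArtinianRing (𝒜 0)] (I : Ideal R) (n : ℕ) :
    Module.length (𝒜 0) (idealPiece 𝒜 I n) ≠ ⊤ := by
  have : IsNoetherian (𝒜 0) (idealPiece 𝒜 I n) :=
    isNoetherian_of_injective (Submodule.inclusion inf_le_left : _ →ₗ[𝒜 0] gradedPiece 𝒜 n)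
      (Submodule.inclusion_injective _)
  have := isArtinian_of_fg_of_artinian' (R := 𝒜 0) (M := idealPiece 𝒜 I n)
  exact Module.length_ne_top

lemma length_gradedPiece_ne_top [IsNoetherianRing R] [IsArtinianRing (𝒜 0)] (n : ℕ) :
    Module.length (𝒜 0) (gradedPiece 𝒜 n) ≠ ⊤ := by
  rw [← idealPiece_top]
  exact length_idealPiece_ne_top ⊤ n

variable (𝒜) in
/-- The length of the degree `n` part of `I`, as a real number. -/
noncomputable def hilbertFun (I : Ideal R) (n : ℕ) : ℝ :=
  ((Module.length (𝒜 0) (idealPiece 𝒜 I n)).toNat : ℝ)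

variable (𝒜) in
/-- The Hilbert series of `R / I`, for an ideal `I` containing all elements of large degree. -/
noncomputable def quotientHilbert (I : Ideal R) : ℝ[X] :=
  ∑ᶠ m, Polynomial.monomial m (hilbertFun 𝒜 ⊤ m - hilbertFun 𝒜 I m)

lemma hilbertFun_eq_top_of_subset {I : Ideal R} {m : ℕ} (h : (𝒜 m : Set R) ⊆ I) :
    hilbertFun 𝒜 I m = hilbertFun 𝒜 ⊤ m := by
  have : idealPiece 𝒜 I m = idealPiece 𝒜 ⊤ m :=
    le_antisymm (idealPiece_mono le_top m) fun x hx => ⟨hx.1, h hx.1⟩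
  rw [hilbertFun, this, hilbertFun]

lemma quotientHilbert_eq_sum {I : Ideal R} {M : ℕ} (hM : ∀ m, M ≤ m → (𝒜 m : Set R) ⊆ I) :
    quotientHilbert 𝒜 I =
      ∑ m ∈ Finset.range M, Polynomial.monomial m (hilbertFun 𝒜 ⊤ m - hilbertFun 𝒜 I m) := by
  refine finsum_eq_sum_of_support_subset _ fun m hm => ?_
  rw [Finset.coe_range, Set.mem_Iio]
  by_contra h
  exact hm (by simp [hilbertFun_eq_top_of_subset (hM m (not_lt.1 h))])

lemma coeff_quotientHilbert {I : Ideal R} (hI : ContainsTail 𝒜 I) (m : ℕ) :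
    (quotientHilbert 𝒜 I).coeff m = hilbertFun 𝒜 ⊤ m - hilbertFun 𝒜 I m := by
  obtain ⟨M, hM⟩ := hI
  rw [quotientHilbert_eq_sum hM, Polynomial.finsetSum_coeff]
  simp only [Polynomial.coeff_monomial, Finset.sum_ite_eq', Finset.mem_range]
  split_ifs with h
  · rfl
  · rw [hilbertFun_eq_top_of_subset (hM m (not_lt.1 h)), sub_self]

variable [IsNoetherianRing R] [IsArtinianRing (𝒜 0)]

lemma coe_length_idealPiece (I : Ideal R) (n : ℕ) :
    Module.length (𝒜 0) (idealPiece 𝒜 I n) =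
      ((Module.length (𝒜 0) (idealPiece 𝒜 I n)).toNat : ℕ∞) :=
  (ENat.natCast_toNat (length_idealPiece_ne_top I n)).symm

lemma hilbertFun_mono {I I' : Ideal R} (h : I ≤ I') (n : ℕ) :
    hilbertFun 𝒜 I n ≤ hilbertFun 𝒜 I' n := by
  refine Nat.cast_le.2 (ENat.toNat_le_toNat ?_ (length_idealPiece_ne_top I' n))
  exact Module.length_le_of_injective (Submodule.inclusion (idealPiece_mono h n))
    (Submodule.inclusion_injective _)

lemma length_quotient_ne_top {I : Ideal R} (hI : I.IsHomogeneous 𝒜) (hT : ContainsTail 𝒜 I) :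
    Module.length R (R ⧸ I) ≠ ⊤ := by
  obtain ⟨M, hM⟩ := hT
  have h := length_quotient_add_sum M hI hM
  intro htop
  rw [htop, top_add] at h
  exact ENat.sum_ne_top.2 (fun m _ => length_gradedPiece_ne_top (𝒜 := 𝒜) m) h.symm

lemma eval_one_quotientHilbert {I : Ideal R} (hI : I.IsHomogeneous 𝒜) (hT : ContainsTail 𝒜 I) :
    (quotientHilbert 𝒜 I).eval 1 = ((Module.length R (R ⧸ I)).toNat : ℝ) := by
  have hne := length_quotient_ne_top hI hT
  obtain ⟨M, hM⟩ := hT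
  have h := length_quotient_add_sum M hI hM
  have htop : ∀ m, Module.length (𝒜 0) (gradedPiece 𝒜 m) =
      ((Module.length (𝒜 0) (idealPiece 𝒜 ⊤ m)).toNat : ℕ∞) := fun m => by
    rw [← coe_length_idealPiece, idealPiece_top]
  rw [← ENat.natCast_toNat hne, Finset.sum_congr rfl fun m _ => coe_length_idealPiece I m,
    Finset.sum_congr rfl fun m _ => htop m] at h
  rw [quotientHilbert_eq_sum hM, Polynomial.eval_finsetSum]
  simp only [Polynomial.eval_monomial, one_pow, mul_one, Finset.sum_sub_distrib, hilbertFun]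
  rw [sub_eq_iff_eq_add]
  exact_mod_cast h.symm

open Pointwise in
lemma quotientHilbert_sup_smul {N I : Ideal R} (hN : N.IsHomogeneous 𝒜) (hI : I.IsHomogeneous 𝒜)
    {f : R} {b : ℕ} (hf : f ∈ 𝒜 b) (hNt : ContainsTail 𝒜 N)
    (hIt : ContainsTail 𝒜 (I ⊓ Submodule.comap (LinearMap.mulLeft R f) N)) :
    quotientHilbert 𝒜 (N ⊔ f • I) + Polynomial.X ^ b *
      quotientHilbert 𝒜 (I ⊓ Submodule.comap (LinearMap.mulLeft R f) N) =
    quotientHilbert 𝒜 N + Polynomial.X ^ b * quotientHilbert 𝒜 I := by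
  ext m
  rw [Polynomial.coeff_add, Polynomial.coeff_add, Polynomial.coeff_X_pow_mul',
    Polynomial.coeff_X_pow_mul', coeff_quotientHilbert hNt, coeff_quotientHilbert hIt,
    coeff_quotientHilbert (hNt.mono le_sup_left), coeff_quotientHilbert (hIt.mono inf_le_left)]
  split_ifs with h
  · obtain ⟨m, rfl⟩ := Nat.exists_eq_add_of_le' h
    have h := length_idealPiece_sup_smul hN hI hf m
    rw [coe_length_idealPiece (N ⊔ f • I), coe_length_idealPiece N, coe_length_idealPiece I,
      coe_length_idealPiece (_ ⊓ _)] at h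
    have h' : hilbertFun 𝒜 (N ⊔ f • I) (m + b) +
        hilbertFun 𝒜 (I ⊓ Submodule.comap (LinearMap.mulLeft R f) N) m =
        hilbertFun 𝒜 N (m + b) + hilbertFun 𝒜 I m := by
      unfold hilbertFun
      exact_mod_cast h
    rw [Nat.add_sub_cancel]
    linarith
  · rw [hilbertFun, hilbertFun, hilbertFun, idealPiece_sup_smul_of_lt hN hf (not_le.1 h)]

end Hilbert

end Graded

/-! ### Filtrations close to the `J`-adic one and rationality of the bigraded series. -/

/-- The Artin–Rees argument: a `J`-filtration contained in the stable `J`-adic one is stable. -/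
lemma Ideal.exists_forall_mul_eq_succ {R : Type*} [CommRing R] [IsNoetherianRing R] {J : Ideal R}
    {F : ℕ → Ideal R} (hmono : ∀ n, F (n + 1) ≤ F n) (hmul : ∀ n, J * F n ≤ F (n + 1))
    (hpow : ∀ n, F n ≤ J ^ n) : ∃ n₀, ∀ n ≥ n₀, J * F n = F (n + 1) := by
  let Φ : J.Filtration R := ⟨F, hmono, hmul⟩
  have hle : Φ ≤ J.stableFiltration ⊤ := fun n => by
    change F n ≤ J ^ n • ⊤
    rw [smul_eq_mul, Ideal.mul_top]
    exact hpow n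
  have hstable : Φ.Stable := (J.stableFiltration_stable ⊤).of_le hle
  exact hstable

section Graded

variable {R σ : Type*} [CommRing R] [SetLike σ R] [AddSubgroupClass σ R]
  {𝒜 : ℕ → σ} [GradedRing 𝒜]

variable (𝒜) in
/-- A sequence of homogeneous ideals `F n` with `J ^ (n + 1) ≤ F n ≤ J ^ n` which is closed under
multiplication by `J`. -/
structure IsInterlaced (J : Ideal R) (F : ℕ → Ideal R) : Prop where
  isHomogeneous : ∀ n, (F n).IsHomogeneous 𝒜
  pow_succ_le : ∀ n, J ^ (n + 1) ≤ F n
  le_pow : ∀ n, F n ≤ J ^ n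
  mul_le : ∀ n, J * F n ≤ F (n + 1)

namespace IsInterlaced

variable {J : Ideal R} {F G : ℕ → Ideal R}

lemma of_pow (hJ : J.IsHomogeneous 𝒜) : IsInterlaced 𝒜 J (fun n => J ^ n) where
  isHomogeneous n := hJ.pow n
  pow_succ_le n := Ideal.pow_le_pow_right n.le_succ
  le_pow _ := le_rfl
  mul_le n := (pow_succ' J n).ge

lemma of_pow_succ (hJ : J.IsHomogeneous 𝒜) : IsInterlaced 𝒜 J (fun n => J ^ (n + 1)) where
  isHomogeneous _ := hJ.pow _
  pow_succ_le _ := le_rfl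
  le_pow n := Ideal.pow_le_pow_right n.le_succ
  mul_le n := (pow_succ' J (n + 1)).ge

/-- Modulo `G n` this is the kernel of multiplication by `x` from `F n / G n` to `F (n + 1) / G (n +
1)`. -/
lemma inf_comap_mulLeft (hF : IsInterlaced 𝒜 J F) (hG : IsInterlaced 𝒜 J G)
    {x : R} (hxJ : x ∈ J) {b : ℕ} (hx : x ∈ 𝒜 b) :
    IsInterlaced 𝒜 J fun n => F n ⊓ Submodule.comap (LinearMap.mulLeft R x) (G (n + 1)) where
  isHomogeneous n := by
    refine (hF.isHomogeneous n).inf fun m y hy => ?_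
    change x * (decompose 𝒜 y m : R) ∈ G (n + 1)
    rw [← coe_decompose_mul_add_of_left_mem 𝒜 hx]
    exact hG.isHomogeneous _ _ hy
  pow_succ_le n := le_inf (hF.pow_succ_le n) fun y hy =>
    hG.mul_le n (Ideal.mul_mem_mul hxJ (hG.pow_succ_le n hy))
  le_pow n := inf_le_left.trans (hF.le_pow n)
  mul_le n := Ideal.mul_le.2 fun r hr y hy => by
    refine ⟨hF.mul_le n (Ideal.mul_mem_mul hr hy.1), ?_⟩
    change x * (r * y) ∈ G (n + 1 + 1)
    rw [mul_left_comm]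
    exact hG.mul_le (n + 1) (Ideal.mul_mem_mul hr hy.2)

end IsInterlaced

open Pointwise in
/-- The sequence `n ↦ G n + x F (n - 1)`. -/
def supSMulShift (x : R) (F G : ℕ → Ideal R) : ℕ → Ideal R
  | 0 => G 0
  | n + 1 => G (n + 1) ⊔ x • F n

namespace IsInterlaced

variable {J : Ideal R} {F G : ℕ → Ideal R}

open Pointwise

lemma le_supSMulShift (x : R) (n : ℕ) : G n ≤ supSMulShift x F G n := by
  cases n with
  | zero => exact le_rfl
  | succ n => exact le_sup_left

lemma supSMulShift_le (hF : IsInterlaced 𝒜 J F) (hGF : ∀ n, G n ≤ F n) {x : R} (hxJ : x ∈ J)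
    (n : ℕ) : supSMulShift x F G n ≤ F n := by
  cases n with
  | zero => exact hGF 0
  | succ n =>
    refine sup_le (hGF _) ?_
    rintro _ ⟨y, hy, rfl⟩
    exact hF.mul_le n (Ideal.mul_mem_mul hxJ hy)

/-- Dividing `F` by this filtration gives the cokernel of multiplication by `x` on `⨁ F n / G n`. -/
lemma supSMulShift (hF : IsInterlaced 𝒜 J F) (hG : IsInterlaced 𝒜 J G)
    (hGF : ∀ n, G n ≤ F n) {x : R} (hxJ : x ∈ J) {b : ℕ} (hx : x ∈ 𝒜 b) :
    IsInterlaced 𝒜 J (supSMulShift x F G) where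
  isHomogeneous n := by
    cases n with
    | zero => exact hG.isHomogeneous 0
    | succ n =>
      refine (hG.isHomogeneous _).sup ?_
      rintro m _ ⟨y, hy, rfl⟩
      change (decompose 𝒜 (x * y) m : R) ∈ _
      rcases le_or_gt b m with h | h
      · rw [coe_decompose_mul_of_left_mem_of_le 𝒜 hx h]
        exact Submodule.smul_mem_pointwise_smul _ _ _ (hF.isHomogeneous n _ hy)
      · rw [coe_decompose_mul_of_left_mem_of_not_le 𝒜 hx (not_le.2 h)]
        exact zero_mem _
  pow_succ_le n := (hG.pow_succ_le n).trans (le_supSMulShift x n)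
  le_pow n := (supSMulShift_le hF hGF hxJ n).trans (hF.le_pow n)
  mul_le n := by
    cases n with
    | zero => exact (hG.mul_le 0).trans le_sup_left
    | succ n =>
      change J * (G (n + 1) ⊔ x • F n) ≤ G (n + 2) ⊔ x • F (n + 1)
      rw [Ideal.mul_sup]
      refine sup_le_sup (hG.mul_le (n + 1)) (Ideal.mul_le.2 ?_)
      rintro r hr _ ⟨y, hy, rfl⟩
      have := Submodule.smul_mem_pointwise_smul (r * y) x _
        (hF.mul_le n (Ideal.mul_mem_mul hr hy))
      rw [smul_eq_mul, mul_left_comm] at this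
      exact this

end IsInterlaced

variable (𝒜) in
/-- The bigraded Hilbert series of `⨁ₙ F n / G n`, as a power series in the filtration degree
whose coefficients are polynomials in the internal degree. -/
noncomputable def bigradedHilbert (F G : ℕ → Ideal R) : PowerSeries ℝ[X] :=
  PowerSeries.mk fun n => quotientHilbert 𝒜 (G n) - quotientHilbert 𝒜 (F n)

variable [IsNoetherianRing R] [IsArtinianRing (𝒜 0)]

open Pointwise in
-- Multiplication by `x` has bidegree `(1, b)`, so `(1 - t^b s) H` is the series of its cokernel
-- minus `t^b s` times that of its kernel.
lemma bigradedHilbert_mul_one_sub {J : Ideal R} (hJ : ∀ n, ContainsTail 𝒜 (J ^ n))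
    {F G : ℕ → Ideal R} (hF : IsInterlaced 𝒜 J F) (hG : IsInterlaced 𝒜 J G)
    {x : R} (hxJ : x ∈ J) {b : ℕ} (hx : x ∈ 𝒜 b) :
    bigradedHilbert 𝒜 F G * (1 - PowerSeries.C (Polynomial.X ^ b) * PowerSeries.X) =
      bigradedHilbert 𝒜 F (supSMulShift x F G) -
        PowerSeries.C (Polynomial.X ^ b) * PowerSeries.X * bigradedHilbert 𝒜
          (fun n => F n ⊓ Submodule.comap (LinearMap.mulLeft R x) (G (n + 1))) G := by
  have hK := hF.inf_comap_mulLeft hG hxJ hx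
  ext1 n
  rw [mul_sub, mul_one, mul_comm (bigradedHilbert 𝒜 F G), map_sub, map_sub, mul_assoc, mul_assoc,
    PowerSeries.coeff_C_mul, PowerSeries.coeff_C_mul]
  cases n with
  | zero => simp [bigradedHilbert, supSMulShift]
  | succ n =>
    rw [PowerSeries.coeff_succ_X_mul, PowerSeries.coeff_succ_X_mul]
    simp only [bigradedHilbert, PowerSeries.coeff_mk]
    have h := quotientHilbert_sup_smul (hG.isHomogeneous (n + 1)) (hF.isHomogeneous n) hx
      ((hJ _).mono (hG.pow_succ_le _)) ((hJ _).mono (hK.pow_succ_le n))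
    simp only [supSMulShift]
    linear_combination -h

open Pointwise in
/-- Rationality of the bigraded Hilbert series of a module over the associated graded ring
of `J = (f₁, …, f_d)` which is killed by the `fᵢ` with `i ∉ s`. -/
theorem exists_bigradedHilbert_mul_prod_eq {d : ℕ} {f : Fin d → R} {b : Fin d → ℕ}
    (hf : ∀ i, f i ∈ 𝒜 (b i)) (hJ : ∀ n, ContainsTail 𝒜 (Ideal.span (Set.range f) ^ n))
    (s : Finset (Fin d)) : ∀ {F G : ℕ → Ideal R}
    (_ : IsInterlaced 𝒜 (Ideal.span (Set.range f)) F)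
    (_ : IsInterlaced 𝒜 (Ideal.span (Set.range f)) G)
    (_ : ∀ n, G n ≤ F n) (_ : ∀ i ∉ s, ∀ n, f i • F n ≤ G (n + 1)),
    ∃ Q : ℝ[X][X], bigradedHilbert 𝒜 F G *
      ∏ i ∈ s, (1 - PowerSeries.C (Polynomial.X ^ b i) * PowerSeries.X) = Q := by
  induction s using Finset.induction_on with
  | empty =>
    intro F G hF hG hGF hs
    -- All `fᵢ` kill the module, so `J * F n ≤ G (n + 1)`; by stability the left side is `F (n + 1)`
    -- for large `n`. The module then has finitely many nonzero degrees and its series is a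
    -- polynomial.
    obtain ⟨n₀, hn₀⟩ := Ideal.exists_forall_mul_eq_succ
      (fun n => (hF.le_pow (n + 1)).trans (hF.pow_succ_le n)) hF.mul_le hF.le_pow
    have hzero : ∀ n ≥ n₀ + 1, F n = G n := by
      intro n hn
      obtain ⟨n, rfl⟩ : ∃ k, n = k + 1 := ⟨n - 1, by omega⟩
      refine le_antisymm ?_ (hGF _)
      rw [← hn₀ n (by omega), Ideal.mul_le]
      intro r hr y hy
      have hle : Ideal.span (Set.range f) ≤
          Submodule.comap (LinearMap.mulRight R y) (G (n + 1)) := by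
        rw [Ideal.span_le]
        rintro _ ⟨i, rfl⟩
        exact hs i (Finset.notMem_empty i) n (Submodule.smul_mem_pointwise_smul _ _ _ hy)
      exact hle hr
    refine ⟨(bigradedHilbert 𝒜 F G).trunc (n₀ + 1), ?_⟩
    ext1 n
    rw [Finset.prod_empty, mul_one, Polynomial.coeff_coe, PowerSeries.coeff_trunc]
    split_ifs with h
    · rfl
    · rw [bigradedHilbert, PowerSeries.coeff_mk, hzero n (not_lt.1 h), sub_self]
  | insert i s hi ih =>
    intro F G hF hG hGF hs
    have hxJ : f i ∈ Ideal.span (Set.range f) := Ideal.subset_span ⟨i, rfl⟩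
    have hK := hF.inf_comap_mulLeft hG hxJ (hf i)
    -- Cokernel and kernel of `f i` are both killed by `f i`, so the induction hypothesis applies to
    -- each with `i` removed.
    obtain ⟨Q₁, hQ₁⟩ := ih hF (hF.supSMulShift hG hGF hxJ (hf i))
      (hF.supSMulShift_le hGF hxJ) fun j hj n => by
        by_cases hji : j = i
        · subst hji; exact le_sup_right
        · exact (hs j (by simp [hji, hj]) n).trans le_sup_left
    obtain ⟨Q₂, hQ₂⟩ := ih hK hG
      (fun n y hy => ⟨hGF n hy, hG.mul_le n (Ideal.mul_mem_mul hxJ hy)⟩) fun j hj n => by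
        by_cases hji : j = i
        · subst hji
          rintro _ ⟨y, hy, rfl⟩
          exact hy.2
        · rintro _ ⟨y, hy, rfl⟩
          exact hs j (by simp [hji, hj]) n (Submodule.smul_mem_pointwise_smul _ _ _ hy.1)
    refine ⟨Q₁ - Polynomial.C (Polynomial.X ^ b i) * Polynomial.X * Q₂, ?_⟩
    rw [Finset.prod_insert hi, ← mul_assoc, bigradedHilbert_mul_one_sub hJ hF hG hxJ (hf i),
      sub_mul, hQ₁, mul_assoc, hQ₂]
    simp

end Graded

/-! ### Limits and sums of coefficients of rational power series. -/

lemma tendsto_choose_add_sub_div_pow (d k : ℕ) :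
    Tendsto (fun n : ℕ => (d.factorial : ℝ) * ((d + (n - k)).choose d : ℝ) / ((n + 1 : ℕ) : ℝ) ^ d)
      atTop (𝓝 1) := by
  have h1 : Tendsto (fun n : ℕ => (d.factorial : ℝ) * (n.choose d : ℝ) / (n : ℝ) ^ d)
      atTop (𝓝 1) := by
    have hne : ∀ᶠ n : ℕ in atTop, (n : ℝ) ^ d / (d.factorial : ℝ) ≠ 0 := by
      filter_upwards [eventually_gt_atTop 0] with n hn
      positivity
    refine ((Asymptotics.isEquivalent_iff_tendsto_one hne).1 (isEquivalent_choose d)).congr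
      fun n => ?_
    rw [Pi.div_apply, div_div_eq_mul_div, mul_comm]
  have hN : Tendsto (fun n : ℕ => d + (n - k)) atTop atTop :=
    tendsto_atTop_mono (fun n => Nat.le_add_left _ _) (tendsto_sub_atTop_nat k)
  have h2 : Tendsto (fun n : ℕ => ((d + (n - k) : ℕ) : ℝ) / ((n + 1 : ℕ) : ℝ)) atTop (𝓝 1) := by
    have h3 : Tendsto (fun n : ℕ => 1 + ((d : ℝ) - k - 1) / ((n + 1 : ℕ) : ℝ)) atTop (𝓝 (1 + 0)) :=
      tendsto_const_nhds.add
        (tendsto_const_nhds.div_atTop (tendsto_natCast_atTop_atTop.comp (tendsto_add_atTop_nat 1)))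
    rw [add_zero] at h3
    refine h3.congr' ?_
    filter_upwards [eventually_ge_atTop k] with n hn
    have : ((n + 1 : ℕ) : ℝ) ≠ 0 := by positivity
    rw [Nat.cast_add d, Nat.cast_sub hn]
    field_simp
    push_cast
    ring
  have h3 := (h1.comp hN).mul (h2.pow d)
  rw [one_pow, mul_one] at h3
  refine h3.congr' ?_
  filter_upwards [eventually_gt_atTop k] with n hn
  have hpos : ((d + (n - k) : ℕ) : ℝ) ≠ 0 := by
    have : d + (n - k) ≠ 0 := by omega
    exact_mod_cast this
  simp only [Function.comp_apply]
  rw [div_pow]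
  field_simp

/-- If `∑ aₙ₊₁ sⁿ = q(s) / (1 - s) ^ (d + 1)`, then `d! aₙ / n ^ d` tends to `q(1)`. -/
lemma tendsto_factorial_mul_div_pow {a : ℕ → ℝ} {d : ℕ} {q : ℝ[X]}
    (h : PowerSeries.mk (fun n => a (n + 1)) * (1 - (PowerSeries.X : PowerSeries ℝ)) ^ (d + 1) =
      (q : PowerSeries ℝ)) :
    Tendsto (fun n : ℕ => (d.factorial : ℝ) * a n / (n : ℝ) ^ d) atTop (𝓝 (q.eval 1)) := by
  rw [← tendsto_add_atTop_iff_nat 1]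
  have ha : PowerSeries.mk (fun n => a (n + 1)) =
      (q : PowerSeries ℝ) * (PowerSeries.mk fun n => ((d + n).choose d : ℝ)) := by
    rw [← h, mul_assoc, mul_comm (_ ^ _), PowerSeries.mk_add_choose_mul_one_sub_pow_eq_one, mul_one]
  have hlim : Tendsto (fun n : ℕ => ∑ k ∈ Finset.range (q.natDegree + 1), q.coeff k *
      ((d.factorial : ℝ) * ((d + (n - k)).choose d : ℝ) / ((n + 1 : ℕ) : ℝ) ^ d)) atTop
      (𝓝 (∑ k ∈ Finset.range (q.natDegree + 1), q.coeff k * 1)) :=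
    tendsto_finsetSum _ fun k _ => tendsto_const_nhds.mul (tendsto_choose_add_sub_div_pow d k)
  rw [Polynomial.eval_eq_sum_range]
  simp only [one_pow]
  refine hlim.congr' ?_
  filter_upwards [eventually_ge_atTop q.natDegree] with n hn
  have hcoeff := congrArg (PowerSeries.coeff n) ha
  rw [PowerSeries.coeff_mk, PowerSeries.coeff_mul,
    Finset.Nat.sum_antidiagonal_eq_sum_range_succ_mk] at hcoeff
  have hsub : Finset.range (q.natDegree + 1) ⊆ Finset.range n.succ :=
    Finset.range_mono (by omega)
  rw [hcoeff, ← Finset.sum_subset hsub, Finset.mul_sum, Finset.sum_div]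
  · refine Finset.sum_congr rfl fun k _ => ?_
    rw [PowerSeries.coeff_mk, Polynomial.coeff_coe]
    ring
  · intro k _ hk
    rw [Polynomial.coeff_coe, Polynomial.coeff_eq_zero_of_natDegree_lt (by simpa using hk), zero_mul]

/-- `G` is the Cauchy product of an absolutely summable series with the geometric series of ratio
`c`. -/
lemma hasSum_of_mul_one_sub {G : PowerSeries ℝ} {c S : ℝ} (hc : |c| < 1)
    (h : HasSum (fun n => PowerSeries.coeff n (G * (1 - PowerSeries.C c * PowerSeries.X))) S) :
    HasSum (fun n => PowerSeries.coeff n G) (S * (1 - c)⁻¹) := by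
  set U := G * (1 - PowerSeries.C c * PowerSeries.X) with hU
  have hG : G = U * PowerSeries.mk fun n => c ^ n := by
    have : (1 - PowerSeries.C c * PowerSeries.X) * PowerSeries.mk (fun n => c ^ n) = 1 := by
      ext n
      rw [sub_mul, one_mul, mul_assoc, map_sub, PowerSeries.coeff_C_mul]
      cases n with
      | zero => simp
      | succ n =>
        rw [PowerSeries.coeff_succ_X_mul]
        simp [PowerSeries.coeff_one, pow_succ']
    rw [hU, mul_assoc, this, mul_one]
  have hgeo : Summable fun n => ‖c ^ n‖ := by
    simpa using summable_geometric_of_lt_one (abs_nonneg c) hc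
  have hcoeff : (fun n => PowerSeries.coeff n G) = fun n =>
      ∑ kl ∈ Finset.HasAntidiagonal.antidiagonal n, PowerSeries.coeff kl.1 U * c ^ kl.2 := by
    funext n
    conv_lhs => rw [hG, PowerSeries.coeff_mul]
    simp only [PowerSeries.coeff_mk]
  rw [hcoeff]
  have hs := (summable_norm_sum_mul_antidiagonal_of_summable_norm h.summable.norm hgeo).of_norm
  rw [← h.tsum_eq, ← tsum_geometric_of_abs_lt_one hc,
    tsum_mul_tsum_eq_tsum_sum_antidiagonal_of_summable_norm h.summable.norm hgeo]
  exact hs.hasSum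

lemma hasSum_of_mul_prod_one_sub {ι : Type*} {c : ι → ℝ} {q : ℝ[X]} (s : Finset ι)
    (hc : ∀ i ∈ s, |c i| < 1) : ∀ {G : PowerSeries ℝ}
    (_ : G * ∏ i ∈ s, (1 - PowerSeries.C (c i) * PowerSeries.X) = q),
    HasSum (fun n => PowerSeries.coeff n G) (q.eval 1 * (∏ i ∈ s, (1 - c i))⁻¹) := by
  classical
  induction s using Finset.induction_on with
  | empty =>
    intro G h
    rw [Finset.prod_empty, mul_one] at h
    rw [Finset.prod_empty, inv_one, mul_one, Polynomial.eval_eq_sum_range, h]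
    simp only [one_pow, mul_one, Polynomial.coeff_coe]
    exact hasSum_sum_of_ne_finset_zero fun n hn =>
      Polynomial.coeff_eq_zero_of_natDegree_lt (by simpa using hn)
  | insert i s hi ih =>
    intro G h
    rw [Finset.prod_insert hi, ← mul_assoc] at h
    have := hasSum_of_mul_one_sub (hc i (Finset.mem_insert_self i s))
      (ih (fun j hj => hc j (Finset.mem_insert_of_mem hj)) h)
    rw [Finset.prod_insert hi, mul_inv, mul_comm (_⁻¹) (_⁻¹), ← mul_assoc]
    exact this

/-! ### Specializing the bigraded series at `t = 1` and at `s = 1`. -/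

section Graded

variable {R σ : Type*} [CommRing R] [SetLike σ R] [AddSubgroupClass σ R]
  {𝒜 : ℕ → σ} [GradedRing 𝒜]

lemma map_evalRingHom_bigradedHilbert_mul_prod {d : ℕ} {b : Fin d → ℕ} {F G : ℕ → Ideal R}
    {Q : ℝ[X][X]} (hQ : bigradedHilbert 𝒜 F G *
      ∏ i, (1 - PowerSeries.C (Polynomial.X ^ b i) * PowerSeries.X) = Q) (t : ℝ) :
    PowerSeries.map (Polynomial.evalRingHom t) (bigradedHilbert 𝒜 F G) *
      ∏ i, (1 - PowerSeries.C (t ^ b i) * PowerSeries.X) =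
        (Q.map (Polynomial.evalRingHom t) : PowerSeries ℝ) := by
  rw [Polynomial.polynomial_map_coe, ← hQ, map_mul, map_prod]
  congr 1
  refine Finset.prod_congr rfl fun i _ => ?_
  rw [map_sub, map_one, map_mul, PowerSeries.map_C, PowerSeries.map_X, Polynomial.coe_evalRingHom,
    Polynomial.eval_pow, Polynomial.eval_X]

lemma coeff_map_bigradedHilbert (t : ℝ) (F G : ℕ → Ideal R) (n : ℕ) :
    PowerSeries.coeff n (PowerSeries.map (Polynomial.evalRingHom t) (bigradedHilbert 𝒜 F G)) =
      (quotientHilbert 𝒜 (G n)).eval t - (quotientHilbert 𝒜 (F n)).eval t := by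
  rw [PowerSeries.coeff_map, bigradedHilbert, PowerSeries.coeff_mk, Polynomial.coe_evalRingHom,
    Polynomial.eval_sub]

lemma quotientHilbert_top : quotientHilbert 𝒜 ⊤ = 0 := by
  rw [quotientHilbert_eq_sum (M := 0) fun _ _ _ _ => Submodule.mem_top]
  rfl

lemma eval_quotientHilbert {I : Ideal R} {M : ℕ} (hM : ∀ m, M ≤ m → (𝒜 m : Set R) ⊆ I) (t : ℝ) :
    (quotientHilbert 𝒜 I).eval t =
      ∑ m ∈ Finset.range M, (hilbertFun 𝒜 ⊤ m - hilbertFun 𝒜 I m) * t ^ m := by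
  rw [quotientHilbert_eq_sum hM, Polynomial.eval_finsetSum]
  simp only [Polynomial.eval_monomial]

lemma pow_le_span_of_le {J : Ideal R} (hJ : J ≤ Ideal.span (⋃ i ≥ 1, (𝒜 i : Set R))) (n : ℕ) :
    J ^ n ≤ Ideal.span (⋃ i ≥ n, (𝒜 i : Set R)) := by
  induction n with
  | zero =>
    rw [pow_zero, Ideal.one_eq_top, top_le_iff, Ideal.eq_top_iff_one]
    exact Ideal.subset_span (Set.mem_iUnion₂.2 ⟨0, le_rfl, SetLike.GradedOne.one_mem⟩)
  | succ n ih =>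
    rw [pow_succ]
    refine (Ideal.mul_mono ih hJ).trans ?_
    rw [Ideal.span_mul_span', Ideal.span_le]
    rintro _ ⟨x, hx, y, hy, rfl⟩
    obtain ⟨i, hi, hx⟩ := Set.mem_iUnion₂.1 hx
    obtain ⟨j, hj, hy⟩ := Set.mem_iUnion₂.1 hy
    exact Ideal.subset_span (Set.mem_iUnion₂.2
      ⟨i + j, add_le_add hi hj, SetLike.mul_mem_graded (A := 𝒜) hx hy⟩)

lemma hilbertFun_pow_eq_zero {J : Ideal R} (hJ : J ≤ Ideal.span (⋃ i ≥ 1, (𝒜 i : Set R)))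
    {m n : ℕ} (hmn : m < n) : hilbertFun 𝒜 (J ^ n) m = 0 := by
  have : idealPiece 𝒜 (J ^ n) m = ⊥ := by
    rw [eq_bot_iff]
    rintro x ⟨hx, hx'⟩
    rw [Submodule.mem_bot, ← decompose_of_mem_same 𝒜 hx]
    exact decompose_eq_zero_of_mem_span hmn (pow_le_span_of_le hJ n hx')
  rw [hilbertFun, this, Module.length_bot]
  simp

lemma IsHomogeneousSOP.samuelMultiplicity_eq {d : ℕ} {f : Fin d → R} {b : Fin d → ℕ}
    (hf : IsHomogeneousSOP 𝒜 f b) {e : ℝ}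
    (h : Tendsto (samuelQuotient d (Ideal.span (Set.range f))) atTop (𝓝 e)) :
    samuelMultiplicity (Ideal.span (Set.range f)) = e := by
  rw [samuelMultiplicity, hf.dim_eq]
  exact h.limUnder_eq

lemma poincareSeries_eq_tsum (t : ℝ) :
    poincareSeries 𝒜 t = ∑' m, hilbertFun 𝒜 ⊤ m * t ^ m :=
  tsum_congr fun m => by rw [hilbertFun, idealPiece_top]

lemma IsHomogeneousSOP.span_le_span [IsNoetherianRing R] [IsArtinianRing (𝒜 0)]
    [IsLocalRing (𝒜 0)] {d : ℕ} {f : Fin d → R} {b : Fin d → ℕ} (hf : IsHomogeneousSOP 𝒜 f b) :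
    Ideal.span (Set.range f) ≤ Ideal.span (⋃ i ≥ 1, (𝒜 i : Set R)) := by
  refine Ideal.span_mono ?_
  rintro _ ⟨i, rfl⟩
  exact Set.mem_iUnion₂.2 ⟨b i, hf.deg_pos i, hf.mem_deg i⟩

variable [IsNoetherianRing R] [IsArtinianRing (𝒜 0)]

lemma tendsto_samuelQuotient {J : Ideal R} (hJ : J.IsHomogeneous 𝒜)
    (hT : ∀ n, ContainsTail 𝒜 (J ^ n)) {d : ℕ} {b : Fin d → ℕ} {Q : ℝ[X][X]}
    (hQ : bigradedHilbert 𝒜 (fun n => J ^ n) (fun n => J ^ (n + 1)) *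
      ∏ i, (1 - PowerSeries.C (Polynomial.X ^ b i) * PowerSeries.X) = Q) :
    Tendsto (samuelQuotient d J) atTop (𝓝 ((Q.map (Polynomial.evalRingHom 1)).eval 1)) := by
  have h := map_evalRingHom_bigradedHilbert_mul_prod hQ 1
  simp only [one_pow, map_one, one_mul, Finset.prod_const, Finset.card_univ,
    Fintype.card_fin] at h
  refine tendsto_factorial_mul_div_pow (a := fun n => ((Module.length R (R ⧸ J ^ n)).toNat : ℝ)) ?_
  -- One factor `1 - s` turns lengths of `R / J^(n+1)` into those of `J^n / J^(n+1)`; the constant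
  -- term fits because `R / J^0` has length zero.
  rw [pow_succ', ← mul_assoc, ← h]
  congr 1
  ext n
  rw [coeff_map_bigradedHilbert, eval_one_quotientHilbert (hJ.pow _) (hT _),
    eval_one_quotientHilbert (hJ.pow _) (hT _), mul_sub, mul_one, map_sub, PowerSeries.coeff_mk]
  congr 1
  cases n with
  | zero =>
    rw [pow_zero, Ideal.one_eq_top, Module.length_eq_zero]
    simp
  | succ n => rw [PowerSeries.coeff_succ_mul_X, PowerSeries.coeff_mk]

/-- By telescoping, `S` is the limit of the increasing values at `t` of the Hilbert series of `R /
J^n`. Each of these is at most the full series of `R`, and it dominates the first `n` terms of that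
series since `J^n` vanishes in degrees below `n`. -/
lemma hasSum_hilbertFun_top {J : Ideal R} (hJ : J ≤ Ideal.span (⋃ i ≥ 1, (𝒜 i : Set R)))
    (hT : ∀ n, ContainsTail 𝒜 (J ^ n)) {t S : ℝ} (ht : 0 ≤ t)
    (h : HasSum (fun n => (quotientHilbert 𝒜 (J ^ (n + 1))).eval t -
      (quotientHilbert 𝒜 (J ^ n)).eval t) S) :
    HasSum (fun m => hilbertFun 𝒜 ⊤ m * t ^ m) S := by
  have hlim : Tendsto (fun n => (quotientHilbert 𝒜 (J ^ n)).eval t) atTop (𝓝 S) := by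
    have := h.tendsto_sum_nat
    simp only [Finset.sum_range_sub (fun n => (quotientHilbert 𝒜 (J ^ n)).eval t), pow_zero,
      Ideal.one_eq_top, quotientHilbert_top, Polynomial.eval_zero, sub_zero] at this
    exact this
  have hnn : ∀ m, 0 ≤ hilbertFun 𝒜 ⊤ m * t ^ m := fun m =>
    mul_nonneg (Nat.cast_nonneg _) (pow_nonneg ht m)
  have hterm : ∀ n m, 0 ≤ (hilbertFun 𝒜 ⊤ m - hilbertFun 𝒜 (J ^ n) m) * t ^ m := fun n m =>
    mul_nonneg (sub_nonneg.2 (hilbertFun_mono le_top m)) (pow_nonneg ht m)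
  have hmono : Monotone fun n => (quotientHilbert 𝒜 (J ^ n)).eval t := by
    refine monotone_nat_of_le_succ fun n => ?_
    obtain ⟨M, hM⟩ := hT (n + 1)
    rw [eval_quotientHilbert hM, eval_quotientHilbert fun m hm =>
      (hM m hm).trans (Ideal.pow_le_pow_right n.le_succ)]
    exact Finset.sum_le_sum fun m _ => mul_le_mul_of_nonneg_right
      (sub_le_sub_left (hilbertFun_mono (Ideal.pow_le_pow_right n.le_succ) m) _) (pow_nonneg ht m)
  have hle : ∀ k, ∑ m ∈ Finset.range k, hilbertFun 𝒜 ⊤ m * t ^ m ≤ S := by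
    intro k
    refine le_trans ?_ (hmono.ge_of_tendsto hlim k)
    obtain ⟨M, hM⟩ := hT k
    rw [eval_quotientHilbert (M := max M k) fun m hm => hM m ((le_max_left _ _).trans hm)]
    refine le_trans (Finset.sum_le_sum fun m hm => ?_) (Finset.sum_le_sum_of_subset_of_nonneg
      (Finset.range_mono (le_max_right M k)) fun m _ _ => hterm k m)
    rw [hilbertFun_pow_eq_zero hJ (Finset.mem_range.1 hm), sub_zero]
  have hs : Summable fun m => hilbertFun 𝒜 ⊤ m * t ^ m := summable_of_sum_range_le hnn hle
  have hS : ∑' m, hilbertFun 𝒜 ⊤ m * t ^ m = S := by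
    refine le_antisymm (Real.tsum_le_of_sum_range_le hnn hle) (le_of_tendsto' hlim fun n => ?_)
    obtain ⟨M, hM⟩ := hT n
    rw [eval_quotientHilbert hM]
    refine (Finset.sum_le_sum fun m _ => ?_).trans (hs.sum_le_tsum (Finset.range M) fun m _ => hnn m)
    exact mul_le_mul_of_nonneg_right (sub_le_self _ (Nat.cast_nonneg _)) (pow_nonneg ht m)
  exact hS ▸ hs.hasSum

variable [IsLocalRing (𝒜 0)]

namespace IsHomogeneousSOP

variable {d : ℕ} {f : Fin d → R} {b : Fin d → ℕ}

/-- A two-variable form of the multiplicity formula. -/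
theorem exists_polynomial (hf : IsHomogeneousSOP 𝒜 f b) : ∃ Q : ℝ[X][X],
    Tendsto (samuelQuotient d (Ideal.span (Set.range f))) atTop
      (𝓝 ((Q.eval (Polynomial.C 1)).eval 1)) ∧
    ∀ t : ℝ, 0 ≤ t → t < 1 → HasSum (fun m => hilbertFun 𝒜 ⊤ m * t ^ m)
      ((Q.eval (Polynomial.C 1)).eval t * (∏ i, (1 - t ^ b i))⁻¹) := by
  have hT := hf.containsTail_pow
  obtain ⟨Q, hQ⟩ := exists_bigradedHilbert_mul_prod_eq hf.mem_deg hT Finset.univ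
    (IsInterlaced.of_pow hf.isHomogeneous_span) (IsInterlaced.of_pow_succ hf.isHomogeneous_span)
    (fun n => Ideal.pow_le_pow_right n.le_succ) fun i hi => absurd (Finset.mem_univ i) hi
  have heval : ∀ t : ℝ, (Q.map (Polynomial.evalRingHom t)).eval 1 =
      (Q.eval (Polynomial.C 1)).eval t := fun t => Polynomial.map_evalRingHom_eval t 1 Q
  refine ⟨Q, heval 1 ▸ tendsto_samuelQuotient hf.isHomogeneous_span hT hQ, fun t ht0 ht1 => ?_⟩
  refine hasSum_hilbertFun_top hf.span_le_span hT ht0 ?_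
  have h := hasSum_of_mul_prod_one_sub Finset.univ (fun i _ => ?_)
    (map_evalRingHom_bigradedHilbert_mul_prod hQ t)
  · simp only [coeff_map_bigradedHilbert] at h
    rw [← heval]
    exact h
  · rw [abs_of_nonneg (pow_nonneg ht0 _)]
    exact pow_lt_one₀ ht0 ht1 (hf.deg_pos i).ne'

/-- The Hilbert–Samuel limit is the product of the degrees times the leading coefficient of the
Poincaré series at `1`. -/
theorem tendsto_and_tendsto (hf : IsHomogeneousSOP 𝒜 f b) : ∃ L : ℝ,
    Tendsto (fun t : ℝ => (1 - t) ^ d * poincareSeries 𝒜 t) (𝓝[<] 1) (𝓝 L) ∧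
    Tendsto (samuelQuotient d (Ideal.span (Set.range f))) atTop (𝓝 ((∏ i, (b i : ℝ)) * L)) := by
  obtain ⟨Q, hQ, hP⟩ := hf.exists_polynomial
  have hb : (∏ i, (b i : ℝ)) ≠ 0 :=
    Finset.prod_ne_zero_iff.2 fun i _ => Nat.cast_ne_zero.2 (hf.deg_pos i).ne'
  refine ⟨(Q.eval (Polynomial.C 1)).eval 1 * (∏ i, (b i : ℝ))⁻¹, ?_, ?_⟩
  · have hgeom : Tendsto (fun t : ℝ => ∏ i, ∑ j ∈ Finset.range (b i), t ^ j) (𝓝[<] 1)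
        (𝓝 (∏ i, (b i : ℝ))) := by
      have hc : Continuous fun t : ℝ => ∏ i, ∑ j ∈ Finset.range (b i), t ^ j := by fun_prop
      have := hc.tendsto 1
      simp only [one_pow, Finset.sum_const, Finset.card_range, nsmul_eq_mul, mul_one] at this
      exact this.mono_left nhdsWithin_le_nhds
    have hpoly : Tendsto (fun t : ℝ => (Q.eval (Polynomial.C 1)).eval t) (𝓝[<] 1)
        (𝓝 ((Q.eval (Polynomial.C 1)).eval 1)) :=
      ((Q.eval (Polynomial.C 1)).continuous.tendsto 1).mono_left nhdsWithin_le_nhds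
    refine (hpoly.mul (hgeom.inv₀ hb)).congr' ?_
    filter_upwards [Ioo_mem_nhdsLT (zero_lt_one' ℝ)] with t ht
    have hne : (1 - t) ^ d ≠ 0 := pow_ne_zero d (sub_ne_zero.2 ht.2.ne')
    -- The zero of order `d` at `t = 1` is split off; the remaining geometric sums tend to the
    -- degrees `b i`.
    have hprod : ∏ i, (1 - t ^ b i) = (1 - t) ^ d * ∏ i, ∑ j ∈ Finset.range (b i), t ^ j := by
      rw [Finset.prod_congr rfl fun i _ => (mul_neg_geom_sum t (b i)).symm,
        Finset.prod_mul_distrib, Finset.prod_const, Finset.card_univ, Fintype.card_fin]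
    rw [poincareSeries_eq_tsum, (hP t ht.1.le ht.2).tsum_eq, hprod, mul_inv, mul_left_comm,
      mul_inv_cancel_left₀ hne]
  · rw [mul_left_comm, mul_inv_cancel₀ hb, mul_one]
    exact hQ

end IsHomogeneousSOP

end Graded

theorem proposition2p7 {R σ : Type*} [CommRing R] [SetLike σ R] [AddSubgroupClass σ R]
    (𝒜 : ℕ → σ) [GradedRing 𝒜] [IsNoetherianRing R]
    [IsArtinianRing (𝒜 0)] [IsLocalRing (𝒜 0)]
    {d : ℕ} (f : Fin d → R) (b : Fin d → ℕ) (hf : IsHomogeneousSOP 𝒜 f b) :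
    -- the lengths in the Poincaré series are finite, and the series converges for `|t| < 1`
    (∀ n, Module.length (𝒜 0) (gradedPiece 𝒜 n) ≠ ⊤) ∧
    (∀ t : ℝ, |t| < 1 →
      Summable fun n : ℕ => ((Module.length (𝒜 0) (gradedPiece 𝒜 n)).toNat : ℝ) * t ^ n) ∧
    -- the multiplicity of `J = (f₁, …, f_d)` is well defined
    (∀ n, Module.length R (R ⧸ Ideal.span (Set.range f) ^ n) ≠ ⊤) ∧
    Tendsto (samuelQuotient d (Ideal.span (Set.range f))) atTop
      (𝓝 (samuelMultiplicity (Ideal.span (Set.range f)))) ∧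
    -- the degrees are positive
    (∀ i, 0 < b i) ∧
    -- the limit exists and the formula for `e(J)` holds
    (∃ L : ℝ, Tendsto (fun t : ℝ => (1 - t) ^ d * poincareSeries 𝒜 t) (𝓝[<] 1) (𝓝 L) ∧
      samuelMultiplicity (Ideal.span (Set.range f)) = (∏ i, (b i : ℝ)) * L) ∧
    -- the ratio is the same for every other homogeneous system of parameters
    (∀ (g : Fin d → R) (c : Fin d → ℕ), IsHomogeneousSOP 𝒜 g c →
      samuelMultiplicity (Ideal.span (Set.range f)) / (∏ i, (b i : ℝ)) =
        samuelMultiplicity (Ideal.span (Set.range g)) / (∏ i, (c i : ℝ))) := by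
  have hprod : ∀ {g : Fin d → R} {c : Fin d → ℕ}, IsHomogeneousSOP 𝒜 g c →
      (∏ i, (c i : ℝ)) ≠ 0 := fun hg =>
    Finset.prod_ne_zero_iff.2 fun i _ => Nat.cast_ne_zero.2 (hg.deg_pos i).ne'
  obtain ⟨L, hL, he⟩ := hf.tendsto_and_tendsto
  have hef := hf.samuelMultiplicity_eq he
  refine ⟨length_gradedPiece_ne_top, fun t ht => ?_,
    fun n => length_quotient_ne_top (hf.isHomogeneous_span.pow n) (hf.containsTail_pow n),
    hef ▸ he, hf.deg_pos, ⟨L, hL, hef⟩, fun g c hg => ?_⟩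
  · obtain ⟨Q, -, hQ⟩ := hf.exists_polynomial
    -- The sum formula needs `0 ≤ t`; negative `t` is covered by absolute convergence at `|t|`.
    refine Summable.of_norm ((hQ |t| (abs_nonneg t) ht).summable.congr fun n => ?_)
    rw [norm_mul, norm_pow, Real.norm_natCast, Real.norm_eq_abs, hilbertFun, idealPiece_top]
  · obtain ⟨L', hL', he'⟩ := hg.tendsto_and_tendsto
    rw [hef, hg.samuelMultiplicity_eq he', tendsto_nhds_unique hL' hL,
      mul_div_cancel_left₀ _ (hprod hf), mul_div_cancel_left₀ _ (hprod hg)]
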